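/- Let $\mathsf k$ be a field. Let $A$ be an Artinian Gorenstein (AG) local $\mathsf k$-algebra with maximal ideal $\mathfrak m$ and residue field $A/\mathfrak m=\mathsf k$, that is, $\dim_{\mathsf k}A<\infty$ and $\dim_{\mathsf k}(0:\mathfrak m)=1$; its socle degree is the integer $j_A$ with $\mathfrak m^{j_A}\neq 0=\mathfrak m^{j_A+1}$. For $a,i\ge 0$ put $$Q_A(a)_i=\frac{\mathfrak m^{i}\cap(0:\mathfrak m^{j_A+1-a-i})}{\mathfrak m^{i}\cap(0:\mathfrak m^{j_A-a-i})+\mathfrak m^{i+1}\cap(0:\mathfrak m^{j_A+1-a-i})},\qquad H_A(a)_i=\dim_{\mathsf k}Q_A(a)_i,$$ where $\mathfrak m^{n}=A$ for $n\le 0$. The sequence $\mathcal D(A)=(H_A(0),H_A(1),H_A(2),\dots)$ is the symmetric decomposition of the Hilbert function of $A$ (here extended by zeros beyond its last term $H_A(j_A-2)$). A sequence $\mathcal D=(H(0),H(1),\dots)$ is called realizable if $\mathcal D=\mathcal D(A)$ for some such $A$ (of any embedding dimension). Let $R=\mathsf k[x,y]$ with the standard grading, let $j$ be a nonnegative integer,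 and suppose that either (i) $j\ge 8$ and $H(0)$ is the compressed Gorenstein Hilbert function of socle degree $j$ for $R$, that is, $H(0)_i=\min\{\dim_{\mathsf k}R_i,\dim_{\mathsf k}R_{j-i}\}$ for $0\le i\le j$ and $H(0)_i=0$ for $i>j$; or (ii) $H(0)$ is the Hilbert function of a graded Artinian complete intersection $R/(f,g)$ with $f,g$ homogeneous of degrees $a,b$, where $a+b=j+2$ and $5\le a\le b$. Let $H(1)=(0,1,0,\dots,0,1,0)$, with entries $1$ in degrees $1$ and $j-2$ and $0$ in all other degrees. Then $(H(0),H(1))$ (that is, $(H(0),H(1),0,0,\dots)$) is not realizable, and there is no realizable $\mathcal D$ whose first two terms are $H(0)$ and $H(1)$. -/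

import Mathlib

universe u v

noncomputable section

/-- The Hilbert function `i ↦ dim_k (R_i / I_i)` of the quotient of the standard graded polynomial
ring `R = k[x_1, …, x_r]` by a (homogeneous) ideal `I`. -/
def gradedHilbert (k : Type u) [Field k] {r : ℕ} (I : Ideal (MvPolynomial (Fin r) k)) (i : ℕ) : ℕ :=
  Module.finrank k
    (MvPolynomial.homogeneousSubmodule (Fin r) k i ⧸
      (I.restrictScalars k).submoduleOf (MvPolynomial.homogeneousSubmodule (Fin r) k i))

/-- The compressed Gorenstein Hilbert function of socle degree `j` for `R = k[x_1, …, x_r]`: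
`H_i = min (dim_k R_i) (dim_k R_{j-i})` for `0 ≤ i ≤ j`, and `H_i = 0` for `i > j`. -/
def compressedHilbert (k : Type u) [Field k] (r j i : ℕ) : ℕ :=
  if i ≤ j then
    min (Module.finrank k (MvPolynomial.homogeneousSubmodule (Fin r) k i))
      (Module.finrank k (MvPolynomial.homogeneousSubmodule (Fin r) k (j - i)))
  else 0

/-- `H` is the Hilbert function of a graded complete intersection `k[x,y]/(f,g)` (an Artinian
quotient) with `f`, `g` homogeneous of degrees `a`, `b`. -/
def HasGeneratorDegrees (k : Type u) [Field k] (H : ℕ → ℕ) (a b : ℕ) : Prop :=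
  ∃ f g : MvPolynomial (Fin 2) k, f.IsHomogeneous a ∧ g.IsHomogeneous b ∧
    Module.Finite k (MvPolynomial (Fin 2) k ⧸ Ideal.span {f, g}) ∧
    H = gradedHilbert k (Ideal.span {f, g})

/-- `A` is an Artinian Gorenstein local `k`-algebra with residue field `k`: a local ring, finite
dimensional over `k`, with `A/𝔪 = k`, whose socle `(0 : 𝔪)` is one-dimensional. -/
structure IsAGAlgebra (k : Type u) [Field k] (A : Type v) [CommRing A] [IsLocalRing A]
    [Algebra k A] : Prop where
  finite : Module.Finite k A
  residue : Function.Bijective (algebraMap k (IsLocalRing.ResidueField A))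
  socle : Module.finrank k (Submodule.annihilator (IsLocalRing.maximalIdeal A)) = 1

/-- The socle degree of an Artinian local ring: the `j` with `𝔪^j ≠ 0` and `𝔪^(j+1) = 0`. -/
def socleDegree (A : Type v) [CommRing A] [IsLocalRing A] : ℕ :=
  sInf {n : ℕ | IsLocalRing.maximalIdeal A ^ (n + 1) = ⊥}

/-- The ideal `𝔪^i ∩ (0 : 𝔪^n)`. -/
def loewyMeet (A : Type v) [CommRing A] [IsLocalRing A] (i n : ℕ) : Ideal A :=
  IsLocalRing.maximalIdeal A ^ i ⊓ Submodule.annihilator (IsLocalRing.maximalIdeal A ^ n)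

/-- The dimension `dim_k (N / (N ∩ P))` for ideals `N`, `P`; it is `dim_k (N / P)` if `P ≤ N`. -/
def quotientDim (k : Type u) [Field k] {A : Type v} [CommRing A] [Algebra k A]
    (N P : Ideal A) : ℕ :=
  Module.finrank k (N ⧸ P.submoduleOf N)

/-- The symmetric decomposition of `A`: `symmDecomp k A a i = H_A(a)_i = dim_k Q(a)_i`, where
`Q(a)_i = 𝔪^i ∩ (0 : 𝔪^(j+1-a-i)) / (𝔪^i ∩ (0 : 𝔪^(j-a-i)) + 𝔪^(i+1) ∩ (0 : 𝔪^(j+1-a-i)))`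
and `j` is the socle degree. Powers of `𝔪` with nonpositive exponent are the unit ideal, which is
what truncated subtraction gives; in particular the terms with `a > max 0 (j-2)` are zero. -/
def symmDecomp (k : Type u) [Field k] (A : Type v) [CommRing A] [IsLocalRing A] [Algebra k A]
    (a i : ℕ) : ℕ :=
  quotientDim k (loewyMeet A i (socleDegree A + 1 - a - i))
    (loewyMeet A i (socleDegree A - a - i) ⊔ loewyMeet A (i + 1) (socleDegree A + 1 - a - i))

/-- `D = (D 0, D 1, D 2, …)` (extended by zero) is realizable over `k`: it is the complete symmetric
decomposition of some Artinian Gorenstein local `k`-algebra with residue field `k`. -/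
def IsRealizable (k : Type u) [Field k] (D : ℕ → ℕ → ℕ) : Prop :=
  ∃ (A : Type v) (_ : CommRing A) (_ : IsLocalRing A) (_ : Algebra k A),
    IsAGAlgebra k A ∧ symmDecomp k A = D

/-- The sequence `(H0, H1)`, that is `(H0, H1, 0, 0, …)`. -/
def twoTerm (H0 H1 : ℕ → ℕ) : ℕ → ℕ → ℕ
  | 0 => H0
  | 1 => H1
  | _ => 0

/-- The sequence `(0, 1, 0, …, 0, 1, 0)` with ones in degrees `1` and `j - 2`. -/
def endOnes (j i : ℕ) : ℕ :=
  if i = 1 ∨ i + 2 = j then 1 else 0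

end

/-!
Write `N_t = (0 : 𝔪^t)` and let `s` be the socle degree of `A`. In both cases `j ≥ 8`, `H(0)₁ = 2`
and `H(0)₄ = 5`, because there are no relations of degree at most four
(`compressedHilbert_two`, `gradedHilbert_span_pair`). It is shown that these two values together
with `H(1)₂ = 0` force `H(1)₁ = 0` (`loewyMeet_one_le`), whereas `H(1)₁ = 1` is prescribed.

As `H(0)₁ = 2`, there are `x, y ∈ 𝔪` with `𝔪 = (x, y) + 𝔪 ∩ N_{s-1}`, and then each element of `𝔪^i`
is a form of degree `i` in `x` and `y` modulo `N_{s-i}` (`exists_form_of_mem_pow`). Let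
`z ∈ 𝔪 ∩ N_{s-1}` represent a class of `Q(1)₁`. Since `Q(1)₂ = 0`, the ideal `z𝔪` lies in
`𝔪³ + N_{s-3}`, so that `zx` and `zy` are congruent modulo `N_{s-3}` to cubic forms `v` and `w` in
`x` and `y`. The quartic form `yv - xw` lies in `N_{s-4}`, and `H(0)₄ = 5` says that the only such
form is zero (`quartic_coeff_eq_zero`). Hence `v = xq` and `w = yq` for a quadratic form `q`
(`exists_quadric_of_cubic`). The difference `z - q` carries `x`, `y`, and also `𝔪 ∩ N_{s-1}`, into
`N_{s-3}`. So `(z - q)𝔪 ⊆ N_{s-3}`, that is, `z - q ∈ N_{s-2}`, while `q ∈ 𝔪² ∩ N_{s-1}`: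
the class of `z` in `Q(1)₁` is zero.

In terms of a dual generator, `z` would contribute a form of degree `s - 2` all of whose first
derivatives come from the leading form `F`, without itself coming from `F`; this would need a
generator of degree `s - 2` in the annihilator of `F`, hence one of degree four as well.
-/

open IsLocalRing

/-! ### Dimensions of quotients of ideals -/

section QuotientDim

variable {k : Type u} [Field k] {A : Type v} [CommRing A] [Algebra k A]

lemma le_of_quotientDim_eq_zero [Module.Finite k A] {N P : Ideal A}
    (h : quotientDim k N P = 0) : N ≤ P := by
  have : Module.Finite k N := inferInstanceAs (Module.Finite k (N.restrictScalars k))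
  have : Subsingleton (N ⧸ P.submoduleOf N) := Module.finrank_zero_iff.mp h
  intro a ha
  exact (Submodule.Quotient.mk_eq_zero (P.submoduleOf N) (x := ⟨a, ha⟩)).mp
    (Subsingleton.elim _ _)

lemma quotientDim_eq_zero_of_le {N P : Ideal A} (h : N ≤ P) : quotientDim k N P = 0 := by
  have : Subsingleton (N ⧸ P.submoduleOf N) :=
    Submodule.Quotient.subsingleton_iff.mpr (Submodule.submoduleOf_eq_top.mpr h)
  exact Module.finrank_zero_of_subsingleton

/-- A combination of elements of `N` maps to the same combination of their classes in `N / P`. -/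
lemma mk_sum_smul_eq_iff {N P : Ideal A} {ι : Type*} [Fintype ι] (e : ι → N) (c : ι → k) (a : N) :
    (P.submoduleOf N).mkQ a = ∑ i, c i • (P.submoduleOf N).mkQ (e i) ↔
      (a : A) - ∑ i, c i • (e i : A) ∈ P := by
  have h : ∑ i, c i • (P.submoduleOf N).mkQ (e i) = (P.submoduleOf N).mkQ (∑ i, c i • e i) := by
    rw [map_sum]
    rfl
  rw [h, Submodule.mkQ_apply, Submodule.mkQ_apply, Submodule.Quotient.eq]
  change ((a - ∑ i, c i • e i : N) : A) ∈ P ↔ _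
  simp

lemma exists_span_of_quotientDim_eq [Module.Finite k A] {N P : Ideal A} {n : ℕ}
    (h : quotientDim k N P = n) :
    ∃ e : Fin n → A, (∀ i, e i ∈ N) ∧ ∀ a ∈ N, ∃ c : Fin n → k, a - ∑ i, c i • e i ∈ P := by
  have : Module.Finite k N := inferInstanceAs (Module.Finite k (N.restrictScalars k))
  let b := Module.finBasisOfFinrankEq k (N ⧸ P.submoduleOf N) h
  choose e he using fun i => (P.submoduleOf N).mkQ_surjective (b i)
  refine ⟨fun i => e i, fun i => (e i).2, fun a ha =>
    ⟨b.repr ((P.submoduleOf N).mkQ ⟨a, ha⟩), (mk_sum_smul_eq_iff e _ ⟨a, ha⟩).mp ?_⟩⟩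
  simp only [he, b.sum_repr]

lemma coeff_eq_zero_of_quotientDim_eq {N P : Ideal A} {n : ℕ}
    (h : quotientDim k N P = n) {e : Fin n → A} (heN : ∀ i, e i ∈ N)
    (he : ∀ a ∈ N, ∃ c : Fin n → k, a - ∑ i, c i • e i ∈ P)
    {c : Fin n → k} (hc : ∑ i, c i • e i ∈ P) (i : Fin n) : c i = 0 := by
  let e' : Fin n → N := fun i => ⟨e i, heN i⟩
  have hli : LinearIndependent k fun i => (P.submoduleOf N).mkQ (e' i) := by
    refine linearIndependent_of_top_le_span_of_card_eq_finrank ?_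
      ((Fintype.card_fin n).trans h.symm)
    rintro w -
    obtain ⟨⟨a, ha⟩, rfl⟩ := (P.submoduleOf N).mkQ_surjective w
    obtain ⟨c, hc⟩ := he a ha
    rw [(mk_sum_smul_eq_iff e' c ⟨a, ha⟩).mpr hc]
    exact Submodule.sum_mem _ fun i _ =>
      Submodule.smul_mem _ _ (Submodule.subset_span ⟨i, rfl⟩)
  refine Fintype.linearIndependent_iff.mp hli c ?_ i
  rw [← (mk_sum_smul_eq_iff e' c 0).mpr (by simpa [e'] using hc), map_zero]

end QuotientDim

/-! ### Hilbert functions of binary forms -/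

section HilbertFunction

variable (k : Type u) [Field k]

lemma finrank_homogeneousSubmodule_fin_two (n : ℕ) :
    Module.finrank k (MvPolynomial.homogeneousSubmodule (Fin 2) k n) = n + 1 := by
  let e : {d : Fin 2 →₀ ℕ | d.degree = n} ≃ Finset.HasAntidiagonal.antidiagonal n :=
    { toFun := fun d => ⟨(d.1 0, d.1 1), by
        have := d.2
        simpa [Finsupp.degree_eq_sum] using this⟩
      invFun := fun p => ⟨Finsupp.equivFunOnFinite.symm ![p.1.1, p.1.2], by
        have := Finset.HasAntidiagonal.mem_antidiagonal.mp p.2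
        simpa [Finsupp.degree_eq_sum] using this⟩
      left_inv := fun d => by
        ext i; fin_cases i <;> rfl
      right_inv := fun p => rfl }
  have : Fintype {d : Fin 2 →₀ ℕ | d.degree = n} := Fintype.ofEquiv _ e.symm
  rw [MvPolynomial.homogeneousSubmodule_eq_finsupp_supported,
    (AddMonoidAlgebra.supportedEquivFinsupp (R := k) {d : Fin 2 →₀ ℕ | d.degree = n}).finrank_eq,
    Module.finrank_finsupp_self, Fintype.card_congr e]
  simp

lemma compressedHilbert_two {j i : ℕ} (h : 2 * i ≤ j) : compressedHilbert k 2 j i = i + 1 := by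
  rw [compressedHilbert, if_pos (by omega), finrank_homogeneousSubmodule_fin_two,
    finrank_homogeneousSubmodule_fin_two]
  omega

variable {k}

lemma coeff_mul_eq_zero_of_degree_lt {σ : Type*} {f : MvPolynomial σ k} {a : ℕ}
    (hf : f.IsHomogeneous a) (u : MvPolynomial σ k) {d : σ →₀ ℕ} (hd : d.degree < a) :
    MvPolynomial.coeff d (u * f) = 0 := by
  classical
  rw [MvPolynomial.coeff_mul]
  refine Finset.sum_eq_zero fun p hp => ?_
  rw [hf.coeff_eq_zero, mul_zero]
  have := Finset.HasAntidiagonal.mem_antidiagonal.mp hp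
  have h2 := congrArg Finsupp.degree this
  rw [map_add] at h2
  omega

lemma gradedHilbert_span_pair {f g : MvPolynomial (Fin 2) k} {a b i : ℕ}
    (hf : f.IsHomogeneous a) (hg : g.IsHomogeneous b) (ha : i < a) (hb : i < b) :
    gradedHilbert k (Ideal.span {f, g}) i = i + 1 := by
  have hbot : ((Ideal.span {f, g}).restrictScalars k).submoduleOf
      (MvPolynomial.homogeneousSubmodule (Fin 2) k i) = ⊥ := by
    rw [eq_bot_iff]
    rintro ⟨p, hp⟩ hpI
    change p ∈ Ideal.span {f, g} at hpI
    obtain ⟨u, w, rfl⟩ := Ideal.mem_span_pair.mp hpI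
    rw [Submodule.mem_bot, Subtype.ext_iff]
    ext d
    by_cases hd : d.degree = i
    · simp [coeff_mul_eq_zero_of_degree_lt hf u (hd.trans_lt ha),
        coeff_mul_eq_zero_of_degree_lt hg w (hd.trans_lt hb)]
    · simpa using MvPolynomial.IsHomogeneous.coeff_eq_zero hp hd
  rw [gradedHilbert, hbot, (Submodule.quotEquivOfEqBot _ rfl).finrank_eq,
    finrank_homogeneousSubmodule_fin_two]

end HilbertFunction

/-! ### The first two rows of the symmetric decomposition -/

section SymmetricDecomposition

variable {k : Type u} [Field k] {A : Type v} [CommRing A] [IsLocalRing A]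

lemma mem_annihilator_maximalIdeal_pow {t : ℕ} {a : A} :
    a ∈ Submodule.annihilator (maximalIdeal A ^ t) ↔ ∀ b ∈ maximalIdeal A ^ t, a * b = 0 :=
  Submodule.mem_annihilator

/-- Multiplication by `𝔪^i` carries `(0 : 𝔪^n)` into `(0 : 𝔪^t)` as soon as `n ≤ i + t`. -/
lemma mul_mem_annihilator_maximalIdeal_pow {i t n : ℕ} (h : n ≤ i + t) {a b : A}
    (ha : a ∈ maximalIdeal A ^ i) (hb : b ∈ Submodule.annihilator (maximalIdeal A ^ n)) :
    a * b ∈ Submodule.annihilator (maximalIdeal A ^ t) := by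
  rw [mem_annihilator_maximalIdeal_pow] at hb ⊢
  intro w hw
  rw [mul_comm a b, mul_assoc]
  refine hb _ (Ideal.pow_le_pow_right h ?_)
  rw [pow_add]
  exact Ideal.mul_mem_mul ha hw

lemma maximalIdeal_pow_le_annihilator {s i t : ℕ} (hs : maximalIdeal A ^ (s + 1) = ⊥)
    (h : s + 1 ≤ i + t) : maximalIdeal A ^ i ≤ Submodule.annihilator (maximalIdeal A ^ t) := by
  intro a ha
  rw [mem_annihilator_maximalIdeal_pow]
  intro b hb
  have : a * b ∈ maximalIdeal A ^ (s + 1) :=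
    Ideal.pow_le_pow_right h (by rw [pow_add]; exact Ideal.mul_mem_mul ha hb)
  simpa [hs] using this

lemma annihilator_maximalIdeal_pow_mono {n t : ℕ} (h : n ≤ t) :
    Submodule.annihilator (maximalIdeal A ^ n) ≤ Submodule.annihilator (maximalIdeal A ^ t) :=
  fun _ ha => mem_annihilator_maximalIdeal_pow.mpr fun b hb =>
    mem_annihilator_maximalIdeal_pow.mp ha b (Ideal.pow_le_pow_right h hb)

/-- By Nakayama's lemma, generators of `𝔪` modulo `𝔪 ∩ L + 𝔪²` generate `𝔪` modulo `𝔪 ∩ L`. -/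
lemma maximalIdeal_le_span_pair_sup [IsNoetherianRing A] {x y : A} {L : Ideal A}
    (h : maximalIdeal A ≤ Ideal.span {x, y} ⊔ (maximalIdeal A ⊓ L ⊔ maximalIdeal A ^ 2)) :
    maximalIdeal A ≤ Ideal.span {x, y} ⊔ maximalIdeal A ⊓ L := by
  refine Submodule.le_of_le_smul_of_le_jacobson_bot (IsNoetherian.noetherian _)
    (maximalIdeal_le_jacobson ⊥) ?_
  rwa [smul_eq_mul, ← pow_two, sup_assoc]

/-- If `x` and `y` generate `𝔪` up to elements of `(0 : 𝔪^(s-1))`, then every element of `𝔪^i` is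
a binary form of degree `i` in `x` and `y` up to an element of `(0 : 𝔪^(s-i))`. -/
lemma exists_form_of_mem_pow [Algebra k A] {s : ℕ} {x y : A}
    (hs : maximalIdeal A ^ (s + 1) = ⊥)
    (hres : Function.Surjective (algebraMap k (ResidueField A)))
    (hx : x ∈ maximalIdeal A) (hy : y ∈ maximalIdeal A)
    (hm : maximalIdeal A ≤ Ideal.span {x, y} ⊔
      maximalIdeal A ⊓ Submodule.annihilator (maximalIdeal A ^ (s - 1)))
    (i : ℕ) (hi : i ≤ s) (a : A) (ha : a ∈ maximalIdeal A ^ i) :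
    ∃ c : ℕ → k, a - ∑ t ∈ Finset.range (i + 1), c t • (x ^ (i - t) * y ^ t) ∈
      Submodule.annihilator (maximalIdeal A ^ (s - i)) := by
  induction i generalizing a with
  | zero =>
    obtain ⟨c, hc⟩ := hres (residue A a)
    refine ⟨fun _ => c, maximalIdeal_pow_le_annihilator (i := 1) hs (by omega) ?_⟩
    rw [pow_one, ← residue_eq_zero_iff, map_sub, ← hc, IsScalarTower.algebraMap_apply k A]
    simp [Algebra.smul_def]
  | succ i ih =>
    have hN : ∀ b ∈ Submodule.annihilator (maximalIdeal A ^ (s - i)), ∀ w ∈ maximalIdeal A,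
        w * b ∈ Submodule.annihilator (maximalIdeal A ^ (s - (i + 1))) := fun b hb w hw =>
      mul_mem_annihilator_maximalIdeal_pow (i := 1) (by omega) (by simpa using hw) hb
    -- The elements for which the claim holds form an additive subgroup containing all products.
    rw [pow_succ] at ha
    refine Submodule.mul_induction_on ha (fun b hb w hw => ?_) ?_
    · obtain ⟨p, hp, n, ⟨-, hn⟩, rfl⟩ := Submodule.mem_sup.mp (hm hw)
      obtain ⟨u, v, rfl⟩ := Ideal.mem_span_pair.mp hp
      obtain ⟨c, hc⟩ := ih (by omega) (b * u) (Ideal.mul_mem_right _ _ hb)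
      obtain ⟨d, hd⟩ := ih (by omega) (b * v) (Ideal.mul_mem_right _ _ hb)
      refine ⟨fun t => (if t ≤ i then c t else 0) + (if t = 0 then 0 else d (t - 1)), ?_⟩
      have key : ∑ t ∈ Finset.range (i + 1 + 1),
          ((if t ≤ i then c t else 0) + (if t = 0 then 0 else d (t - 1))) •
            (x ^ (i + 1 - t) * y ^ t) =
          x * ∑ t ∈ Finset.range (i + 1), c t • (x ^ (i - t) * y ^ t) +
          y * ∑ t ∈ Finset.range (i + 1), d t • (x ^ (i - t) * y ^ t) := by
        simp only [add_smul, Finset.sum_add_distrib, Finset.mul_sum]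
        congr 1
        · rw [Finset.sum_range_succ, if_neg (by omega), zero_smul, add_zero]
          refine Finset.sum_congr rfl fun t ht => ?_
          have := Finset.mem_range.mp ht
          rw [if_pos (by omega), show i + 1 - t = i - t + 1 by omega, pow_succ,
            mul_smul_comm]
          congr 1
          ring
        · rw [Finset.sum_range_succ', if_pos rfl, zero_smul, add_zero]
          refine Finset.sum_congr rfl fun t _ => ?_
          rw [if_neg (by omega), show i + 1 - (t + 1) = i - t by omega, pow_succ,
            mul_smul_comm, Nat.add_sub_cancel]
          congr 1
          ring
      rw [key]
      have h1 := add_mem (add_mem (hN _ hc x hx) (hN _ hd y hy))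
        (mul_mem_annihilator_maximalIdeal_pow (t := s - (i + 1)) (by omega) hb hn)
      convert h1 using 1
      ring
    · rintro b w ⟨c, hc⟩ ⟨d, hd⟩
      refine ⟨c + d, ?_⟩
      convert add_mem hc hd using 1
      simp only [Pi.add_apply, add_smul, Finset.sum_add_distrib]
      ring

/-- If `Q(0)₄` has dimension five, there is no relation among the monomials of degree four in two
elements generating `𝔪` up to `(0 : 𝔪^(s-1))`. -/
lemma quartic_coeff_eq_zero [Algebra k A] {s : ℕ} {x y : A} (h4s : 4 ≤ s)
    (hs : maximalIdeal A ^ (s + 1) = ⊥)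
    (hres : Function.Surjective (algebraMap k (ResidueField A)))
    (hx : x ∈ maximalIdeal A) (hy : y ∈ maximalIdeal A)
    (hm : maximalIdeal A ≤ Ideal.span {x, y} ⊔
      maximalIdeal A ⊓ Submodule.annihilator (maximalIdeal A ^ (s - 1)))
    (h4 : quotientDim k (loewyMeet A 4 (s + 1 - 0 - 4))
      (loewyMeet A 4 (s - 0 - 4) ⊔ loewyMeet A (4 + 1) (s + 1 - 0 - 4)) = 5)
    {c : Fin 5 → k} (hc : ∑ t, c t • (x ^ (4 - (t : ℕ)) * y ^ (t : ℕ)) ∈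
      Submodule.annihilator (maximalIdeal A ^ (s - 4))) (t : Fin 5) : c t = 0 := by
  have hmem : ∀ t : Fin 5, x ^ (4 - (t : ℕ)) * y ^ (t : ℕ) ∈ maximalIdeal A ^ 4 := fun t => by
    rw [show 4 = 4 - (t : ℕ) + t by omega, pow_add, Nat.sub_add_cancel (by omega)]
    exact Ideal.mul_mem_mul (Ideal.pow_mem_pow hx _) (Ideal.pow_mem_pow hy _)
  have hsum : ∀ c : Fin 5 → k, ∑ t, c t • (x ^ (4 - (t : ℕ)) * y ^ (t : ℕ)) ∈
      maximalIdeal A ^ 4 := fun c =>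
    Submodule.sum_mem _ fun t _ => Submodule.smul_of_tower_mem _ _ (hmem t)
  refine coeff_eq_zero_of_quotientDim_eq h4
    (e := fun t => x ^ (4 - (t : ℕ)) * y ^ (t : ℕ))
    (fun t => ⟨hmem t, maximalIdeal_pow_le_annihilator hs (by omega) (hmem t)⟩) ?_
    (le_sup_left (a := loewyMeet A 4 (s - 0 - 4)) ⟨hsum c, hc⟩) t
  rintro a ⟨ha, -⟩
  obtain ⟨d, hd⟩ := exists_form_of_mem_pow hs hres hx hy hm 4 h4s a ha
  refine ⟨fun t => d t, le_sup_left (a := loewyMeet A 4 (s - 0 - 4)) ⟨sub_mem ha (hsum _), ?_⟩⟩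
  rwa [Finset.sum_range] at hd

/-- If `zx` and `zy` are congruent to cubic forms `v` and `w` in `x` and `y` modulo
`(0 : 𝔪^(s-3))`, then `yv - xw` annihilates `𝔪^(s-4)`. As there are no quartic relations,
`yv = xw` as forms, so that `v = xq` and `w = yq` for a quadratic form `q`. -/
lemma exists_quadric_of_cubic [Algebra k A] {s : ℕ} {x y z : A} (h4s : 4 ≤ s)
    (hx : x ∈ maximalIdeal A) (hy : y ∈ maximalIdeal A)
    (hquart : ∀ c : Fin 5 → k, ∑ t, c t • (x ^ (4 - (t : ℕ)) * y ^ (t : ℕ)) ∈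
      Submodule.annihilator (maximalIdeal A ^ (s - 4)) → ∀ t, c t = 0)
    {c d : ℕ → k}
    (hc : z * x - ∑ t ∈ Finset.range (3 + 1), c t • (x ^ (3 - t) * y ^ t) ∈
      Submodule.annihilator (maximalIdeal A ^ (s - 3)))
    (hd : z * y - ∑ t ∈ Finset.range (3 + 1), d t • (x ^ (3 - t) * y ^ t) ∈
      Submodule.annihilator (maximalIdeal A ^ (s - 3))) :
    ∃ q ∈ maximalIdeal A ^ 2,
      (z - q) * x ∈ Submodule.annihilator (maximalIdeal A ^ (s - 3)) ∧
      (z - q) * y ∈ Submodule.annihilator (maximalIdeal A ^ (s - 3)) := by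
  simp only [Finset.sum_range_succ, Finset.sum_range_zero, Algebra.smul_def] at hc hd
  have h := hquart ![-d 0, c 0 - d 1, c 1 - d 2, c 2 - d 3, c 3] (by
    convert sub_mem
      (mul_mem_annihilator_maximalIdeal_pow (i := 1) (t := s - 4) (by omega) (by simpa using hx) hd)
      (mul_mem_annihilator_maximalIdeal_pow (i := 1) (t := s - 4) (by omega) (by simpa using hy) hc)
      using 1
    simp [Fin.sum_univ_five, Algebra.smul_def]
    ring)
  have e0 : d 0 = 0 := by simpa using h 0
  have e1 : c 0 = d 1 := by simpa [sub_eq_zero] using h 1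
  have e2 : c 1 = d 2 := by simpa [sub_eq_zero] using h 2
  have e3 : c 2 = d 3 := by simpa [sub_eq_zero] using h 3
  have e4 : c 3 = 0 := by simpa using h 4
  refine ⟨c 0 • (x * x) + c 1 • (x * y) + c 2 • (y * y), ?_, ?_, ?_⟩
  · rw [pow_two]
    exact add_mem (add_mem (Submodule.smul_of_tower_mem _ _ (Ideal.mul_mem_mul hx hx))
      (Submodule.smul_of_tower_mem _ _ (Ideal.mul_mem_mul hx hy)))
      (Submodule.smul_of_tower_mem _ _ (Ideal.mul_mem_mul hy hy))
  · convert hc using 1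
    simp [Algebra.smul_def, e4]
    ring
  · convert hd using 1
    simp [Algebra.smul_def, e0, ← e1, ← e2, ← e3]
    ring

/-- The crux: `H(0)₁ = 2`, `H(0)₄ = 5` and `H(1)₂ = 0` force `Q(1)₁ = 0`. Any `z` representing a
class of `Q(1)₁` is corrected by a quadratic form `q` in such a way that `z - q` annihilates
`𝔪^(s-2)`, which makes the class of `z` zero. -/
lemma loewyMeet_one_le [Algebra k A] [Module.Finite k A] {s : ℕ} (h4s : 4 ≤ s)
    (hs : maximalIdeal A ^ (s + 1) = ⊥)
    (hres : Function.Surjective (algebraMap k (ResidueField A)))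
    (h01 : quotientDim k (loewyMeet A 1 (s + 1 - 0 - 1))
      (loewyMeet A 1 (s - 0 - 1) ⊔ loewyMeet A (1 + 1) (s + 1 - 0 - 1)) = 2)
    (h04 : quotientDim k (loewyMeet A 4 (s + 1 - 0 - 4))
      (loewyMeet A 4 (s - 0 - 4) ⊔ loewyMeet A (4 + 1) (s + 1 - 0 - 4)) = 5)
    (h12 : quotientDim k (loewyMeet A 2 (s + 1 - 1 - 2))
      (loewyMeet A 2 (s - 1 - 2) ⊔ loewyMeet A (2 + 1) (s + 1 - 1 - 2)) = 0) :
    loewyMeet A 1 (s + 1 - 1 - 1) ≤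
      loewyMeet A 1 (s - 1 - 1) ⊔ loewyMeet A (1 + 1) (s + 1 - 1 - 1) := by
  have : IsNoetherianRing A := IsNoetherianRing.of_finite k A
  -- Generators of `𝔪` up to `(0 : 𝔪^(s-1))`.
  obtain ⟨e, he, hspan⟩ := exists_span_of_quotientDim_eq h01
  have hx : e 0 ∈ maximalIdeal A := by simpa using (he 0).1
  have hy : e 1 ∈ maximalIdeal A := by simpa using (he 1).1
  generalize hxe : e 0 = x at hx
  generalize hye : e 1 = y at hy
  have hm : maximalIdeal A ≤ Ideal.span {x, y} ⊔
      maximalIdeal A ⊓ Submodule.annihilator (maximalIdeal A ^ (s - 1)) := by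
    refine maximalIdeal_le_span_pair_sup fun a ha => ?_
    obtain ⟨c, hc⟩ := hspan a ⟨by simpa using ha,
      maximalIdeal_pow_le_annihilator (i := 1) hs (by omega) (by simpa using ha)⟩
    rw [Fin.sum_univ_two, hxe, hye] at hc
    rw [← add_sub_cancel (c 0 • x + c 1 • y) a]
    refine Submodule.add_mem_sup (Ideal.mem_span_pair.mpr
      ⟨algebraMap k A (c 0), algebraMap k A (c 1), by simp [Algebra.smul_def]⟩) ?_
    have hle : loewyMeet A 1 (s - 0 - 1) ⊔ loewyMeet A (1 + 1) (s + 1 - 0 - 1) ≤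
        maximalIdeal A ⊓ Submodule.annihilator (maximalIdeal A ^ (s - 1)) ⊔ maximalIdeal A ^ 2 :=
      sup_le_sup (by rw [loewyMeet, pow_one, Nat.sub_zero]) inf_le_left
    exact hle hc
  -- Multiplication by `z` carries `𝔪` into `𝔪³ + (0 : 𝔪^(s-3))`, since `Q(1)₂ = 0`.
  rintro z ⟨hz, hzN⟩
  rw [pow_one] at hz
  rw [show s + 1 - 1 - 1 = s - 1 by omega] at hzN
  have hzm : ∀ a ∈ maximalIdeal A, ∃ u ∈ Submodule.annihilator (maximalIdeal A ^ (s - 3)),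
      ∃ v ∈ maximalIdeal A ^ 3, u + v = z * a := by
    intro a ha
    obtain ⟨u, hu, v, hv, huv⟩ := Submodule.mem_sup.mp
      (le_of_quotientDim_eq_zero h12 (x := z * a) ⟨by
        rw [pow_two]
        exact Ideal.mul_mem_mul hz ha, by
        rw [mul_comm]
        exact mul_mem_annihilator_maximalIdeal_pow (i := 1) (by omega) (by simpa using ha) hzN⟩)
    exact ⟨u, annihilator_maximalIdeal_pow_mono (by omega) hu.2, v, hv.1, huv⟩
  have hform : ∀ a ∈ maximalIdeal A, ∃ c : ℕ → k,
      z * a - ∑ t ∈ Finset.range (3 + 1), c t • (x ^ (3 - t) * y ^ t) ∈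
        Submodule.annihilator (maximalIdeal A ^ (s - 3)) := by
    intro a ha
    obtain ⟨u, hu, v, hv, huv⟩ := hzm a ha
    obtain ⟨c, hc⟩ := exists_form_of_mem_pow hs hres hx hy hm 3 (by omega) v hv
    refine ⟨c, ?_⟩
    rw [← huv, add_sub_assoc]
    exact add_mem hu hc
  obtain ⟨c, hc⟩ := hform x hx
  obtain ⟨d, hd⟩ := hform y hy
  obtain ⟨q, hq, hqx, hqy⟩ := exists_quadric_of_cubic h4s hx hy
    (fun c hc => quartic_coeff_eq_zero h4s hs hres hx hy hm h04 hc) hc hd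
  -- The other generators `n` of `𝔪` kill `𝔪^(s-1)`; for them both `zn` and `qn` kill `𝔪^(s-3)`.
  have hzn : ∀ n ∈ maximalIdeal A, n ∈ Submodule.annihilator (maximalIdeal A ^ (s - 1)) →
      (z - q) * n ∈ Submodule.annihilator (maximalIdeal A ^ (s - 3)) := by
    intro n hnm hn
    rw [sub_mul]
    refine sub_mem ?_ (mul_mem_annihilator_maximalIdeal_pow (by omega) hq hn)
    rw [mem_annihilator_maximalIdeal_pow] at hn ⊢
    intro b hb
    rw [show s - 3 = 1 + (s - 4) by omega, pow_add, pow_one] at hb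
    refine Submodule.mul_induction_on hb (fun a ha w hw => ?_) fun a b ha hb => by
      rw [mul_add, ha, hb, add_zero]
    -- With `za = u + v` as in `hzm`, both `u(nw)` and `n(vw)` vanish.
    obtain ⟨u, hu, v, hv, huv⟩ := hzm a ha
    have h1 : u * (n * w) = 0 := by
      refine mem_annihilator_maximalIdeal_pow.mp hu _ ?_
      rw [show s - 3 = 1 + (s - 4) by omega, pow_add, pow_one]
      exact Ideal.mul_mem_mul hnm hw
    have h2 : n * (v * w) = 0 := by
      refine hn _ ?_
      rw [show s - 1 = 3 + (s - 4) by omega, pow_add]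
      exact Ideal.mul_mem_mul hv hw
    linear_combination h1 + h2 - n * w * huv
  have hqs : q ∈ Submodule.annihilator (maximalIdeal A ^ (s - 1)) :=
    maximalIdeal_pow_le_annihilator hs (by omega) hq
  rw [← sub_add_cancel z q]
  refine Submodule.add_mem_sup ⟨?_, ?_⟩ ⟨hq, by
    rwa [show s + 1 - 1 - 1 = s - 1 by omega]⟩
  · rw [pow_one]
    exact sub_mem hz (Ideal.pow_le_self two_ne_zero hq)
  · rw [show s - 1 - 1 = 1 + (s - 3) by omega]
    refine mem_annihilator_maximalIdeal_pow.mpr ?_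
    intro b hb
    rw [pow_add, pow_one] at hb
    refine Submodule.mul_induction_on hb (fun a ha w hw => ?_) fun a b ha hb => by
      rw [mul_add, ha, hb, add_zero]
    obtain ⟨p, hp, n, ⟨hnm, hn⟩, rfl⟩ := Submodule.mem_sup.mp (hm ha)
    obtain ⟨u, v, rfl⟩ := Ideal.mem_span_pair.mp hp
    have h1 := mem_annihilator_maximalIdeal_pow.mp (hzn n hnm hn) w hw
    have h2 := mem_annihilator_maximalIdeal_pow.mp hqx w hw
    have h3 := mem_annihilator_maximalIdeal_pow.mp hqy w hw
    linear_combination h1 + u * h2 + v * h3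

lemma maximalIdeal_pow_socleDegree_succ [IsArtinianRing A] :
    maximalIdeal A ^ (socleDegree A + 1) = ⊥ := by
  have hne : {n : ℕ | maximalIdeal A ^ (n + 1) = ⊥}.Nonempty := by
    obtain ⟨n, hn⟩ := IsArtinianRing.isNilpotent_jacobson_bot (R := A)
    refine ⟨n, ?_⟩
    rw [jacobson_eq_maximalIdeal _ bot_ne_top] at hn
    rw [Set.mem_ofPred_eq, pow_succ, hn]
    exact Ideal.bot_mul _
  exact Nat.sInf_mem hne

end SymmetricDecomposition

/-! ### Nonrealizability -/

theorem mainTheorem7 {k : Type u} [Field k] (j : ℕ) (H0 : ℕ → ℕ)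
    (hH0 : (8 ≤ j ∧ H0 = compressedHilbert k 2 j) ∨
      ∃ a b : ℕ, 5 ≤ a ∧ a ≤ b ∧ a + b = j + 2 ∧ HasGeneratorDegrees k H0 a b) :
    ¬ IsRealizable.{u, v} k (twoTerm H0 (endOnes j)) ∧
      ¬ ∃ D : ℕ → ℕ → ℕ, IsRealizable.{u, v} k D ∧ D 0 = H0 ∧ D 1 = endOnes j := by
  have hdata : 8 ≤ j ∧ H0 1 = 2 ∧ H0 4 = 5 := by
    rcases hH0 with ⟨hj, rfl⟩ | ⟨a, b, ha, hab, habj, f, g, hf, hg, -, rfl⟩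
    · exact ⟨hj, compressedHilbert_two k (by omega), compressedHilbert_two k (by omega)⟩
    · exact ⟨by omega, gradedHilbert_span_pair hf hg (by omega) (by omega),
        gradedHilbert_span_pair hf hg (by omega) (by omega)⟩
  obtain ⟨hj, h1, h4⟩ := hdata
  have main : ¬ ∃ D : ℕ → ℕ → ℕ, IsRealizable.{u, v} k D ∧ D 0 = H0 ∧ D 1 = endOnes j := by
    rintro ⟨D, ⟨A, _, _, _, hA, rfl⟩, hD0, hD1⟩
    have := hA.finite
    have : IsArtinianRing A := IsArtinianRing.of_finite k A
    have hs := maximalIdeal_pow_socleDegree_succ (A := A)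
    rw [← hD0] at h1 h4
    have h11 : symmDecomp k A 1 1 = 1 := by simp [hD1, endOnes]
    have h12 : symmDecomp k A 1 2 = 0 := by
      rw [hD1, endOnes, if_neg (by omega)]
    -- `Q(0)₄ ≠ 0` bounds the socle degree from below.
    have h4s : 4 ≤ socleDegree A := by
      by_contra hlt
      have hpow : maximalIdeal A ^ 4 = ⊥ :=
        le_bot_iff.mp ((Ideal.pow_le_pow_right (by omega)).trans hs.le)
      have : symmDecomp k A 0 4 = 0 := quotientDim_eq_zero_of_le (by
        simp [loewyMeet, hpow])
      omega
    have : symmDecomp k A 1 1 = 0 := quotientDim_eq_zero_of_le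
      (loewyMeet_one_le h4s hs hA.residue.surjective h1 h4 h12)
    omega
  exact ⟨fun h => main ⟨_, h, rfl, rfl⟩, main⟩
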